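/- Let $\Sigma_g$ be a closed connected orientable surface of genus $g$, and let $L=K_1\cup\cdots\cup K_n$ be a link diagram on $\Sigma_g$ with components $K_1,\dots,K_n$, i.e. $n$ closed curves on $\Sigma_g$ whose only singularities are finitely many transverse double points (the crossings $C_1,\dots,C_c$), together with a choice of the upper strand at each crossing. Let $R_1,\dots,R_r$ be the regions of $L$, i.e. the connected components of $\Sigma_g\setminus L$; they need not be disks. Locally there are four sectors around each crossing; let $m_{ij}\in\{0,\dots,4\}$ be the number of sectors around $C_j$ that belong to $R_i$, and let $M_L$ be the $r\times c$ matrix over $\mathbb{Z}_2$ with entries $m_{ij}\bmod 2$. Let $\alpha_1,\dots,\alpha_{2g}$ be a basis of $H_1(\Sigma_g;\mathbb{Z}_2)$, write $[K_i]=\sum_{j=1}^{2g} b_{ij}\alpha_j$, and let $N_L=(b_{ij})$ be the resulting $n\times 2g$ matrix over $\mathbb{Z}_2$. Then $$\operatorname{rank}_{\mathbb{Z}_2}(M_L)=r-n-1+\operatorname{rank}_{\mathbb{Z}_2}(N_L).$$ Moreover, let the (modified, double-counting) region crossing change on $R_i$ be the operation that switches each crossing $C_j$ exactly $m_{ij}$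 times, and call two link diagrams with the same projection as $L$ (that is, differing from $L$ only in the choice of upper strands) equivalent if they are related by a finite sequence of region crossing changes. Then the number of equivalence classes of link diagrams with the same projection as $L$ is $2^{\,c-\operatorname{rank}_{\mathbb{Z}_2}(M_L)}$. -/

import Mathlib

noncomputable section

/-- A closed connected oriented surface, presented as a finite cell complex by its rotation system.
`D` is the set of darts, i.e. of edges of the 1-skeleton together with a direction. A dart points
away from its initial vertex; `rot` sends a dart to the next one counterclockwise around that
vertex, and `flip` reverses the direction of a dart. The vertices, edges and faces of the complex
are the cycles of `rot`, of `flip`, and of the permutation that follows the boundary of a face.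
Gluing one open disk per face to the 1-skeleton gives a closed connected orientable surface, and
every closed connected orientable surface with a finite graph whose complementary pieces are
open disks arises so. -/
structure CellSurface (D : Type*) [Fintype D] where
  rot : Equiv.Perm D
  flip : Equiv.Perm D
  flip_flip : ∀ d, flip (flip d) = d
  flip_ne : ∀ d, flip d ≠ d
  nonempty : Nonempty D
  connected : ∀ d d' : D, ∃ p ∈ Subgroup.closure {rot, flip}, p d = d'

namespace CellSurface

variable {D : Type*} [Fintype D] (S : CellSurface D)

/-- The dart that follows `d` on the boundary of the face lying to the left of `d`: at the head of
`d`, take the next dart clockwise after the reverse of `d`. -/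
def facePerm : Equiv.Perm D := S.rot⁻¹ * S.flip

def Vertex : Type _ := Quotient (Equiv.Perm.SameCycle.setoid S.rot)

def Edge : Type _ := Quotient (Equiv.Perm.SameCycle.setoid S.flip)

def Face : Type _ := Quotient (Equiv.Perm.SameCycle.setoid S.facePerm)

/-- The initial vertex of a dart. -/
def vertex (d : D) : S.Vertex := Quotient.mk _ d

/-- The edge underlying a dart. -/
def edge (d : D) : S.Edge := Quotient.mk _ d

/-- The face to the left of a dart. It is also the face that occupies, at the initial vertex of
`d`, the corner between `d` and `S.rot d`. -/
def face (d : D) : S.Face := Quotient.mk _ d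

instance : Finite S.Vertex := inferInstanceAs (Finite (Quotient _))

instance : Finite S.Edge := inferInstanceAs (Finite (Quotient _))

instance : Finite S.Face := inferInstanceAs (Finite (Quotient _))

def eulerChar : ℤ := (Nat.card S.Vertex : ℤ) - Nat.card S.Edge + Nat.card S.Face

open Classical in
/-- The boundary of cellular 2-chains mod 2: an edge is counted once for each of its two sides. -/
def boundary₂ : (S.Face → ZMod 2) →ₗ[ZMod 2] (S.Edge → ZMod 2) where
  toFun c e := ∑ d with S.edge d = e, c (S.face d)
  map_add' c c' := by
    funext e
    simp [Finset.sum_add_distrib]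
  map_smul' t c := by
    funext e
    simp [Finset.mul_sum]

open Classical in
/-- The boundary of cellular 1-chains mod 2: a vertex is counted once for each edge end at it. -/
def boundary₁ : (S.Edge → ZMod 2) →ₗ[ZMod 2] (S.Vertex → ZMod 2) where
  toFun c v := ∑ d with S.vertex d = v, c (S.edge d)
  map_add' c c' := by
    funext e
    simp [Finset.sum_add_distrib]
  map_smul' t c := by
    funext e
    simp [Finset.mul_sum]

/-- The first homology with `ZMod 2` coefficients: cycles modulo boundaries. -/
abbrev H1 : Type _ :=
  LinearMap.ker S.boundary₁ ⧸ (LinearMap.range S.boundary₂).submoduleOf (LinearMap.ker S.boundary₁)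

theorem vertex_rot_pow (d : D) (k : ℕ) : S.vertex ((S.rot ^ k) d) = S.vertex d :=
  Quotient.sound (s := Equiv.Perm.SameCycle.setoid S.rot)
    (show S.rot.SameCycle _ _ from ⟨-k, by simp⟩)

theorem exists_rot_pow_of_vertex_eq {d d' : D} (h : S.vertex d = S.vertex d') :
    ∃ k : ℕ, (S.rot ^ k) d = d' := by
  have h' : S.rot.SameCycle d d' := Quotient.exact (s := Equiv.Perm.SameCycle.setoid S.rot) h
  obtain ⟨k, -, hk⟩ := h'.exists_pow_eq'
  exact ⟨k, hk⟩

theorem eq_or_eq_flip_of_edge_eq {d d' : D} (h : S.edge d = S.edge d') :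
    d = d' ∨ S.flip d = d' := by
  have h' : S.flip.SameCycle d d' := Quotient.exact (s := Equiv.Perm.SameCycle.setoid S.flip) h
  obtain ⟨k, -, hk⟩ := h'.exists_pow_eq'
  rcases Nat.even_or_odd' k with ⟨m, rfl | rfl⟩
  · left
    have : S.flip ^ 2 = 1 := by ext d; simp [pow_two, S.flip_flip]
    simpa [pow_mul, this] using hk
  · right
    have : S.flip ^ 2 = 1 := by ext d; simp [pow_two, S.flip_flip]
    simpa [pow_succ, pow_mul, this] using hk

theorem boundary₁_boundary₂ (c : S.Face → ZMod 2) : S.boundary₁ (S.boundary₂ c) = 0 := by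
  classical
  have hflip : ∀ d, S.face (S.flip (S.rot d)) = S.face d := fun d =>
    Quotient.sound (s := Equiv.Perm.SameCycle.setoid S.facePerm)
      (show S.facePerm.SameCycle _ _ from ⟨1, by simp [facePerm, S.flip_flip]⟩)
  have hedge : ∀ d d', S.edge d' = S.edge d ↔ d' = d ∨ d' = S.flip d := by
    refine fun d d' => ⟨fun h => ?_, ?_⟩
    · rcases S.eq_or_eq_flip_of_edge_eq h with h' | h'
      · exact Or.inl h'
      · exact Or.inr (by rw [← h', S.flip_flip])
    · rintro (rfl | rfl)
      · rfl
      · exact Quotient.sound (s := Equiv.Perm.SameCycle.setoid S.flip)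
          (show S.flip.SameCycle _ _ from ⟨1, by simp [S.flip_flip]⟩)
  have h2 : ∀ d, S.boundary₂ c (S.edge d) = c (S.face d) + c (S.face (S.flip d)) := by
    intro d
    have : Finset.univ.filter (fun d' => S.edge d' = S.edge d) = {d, S.flip d} := by
      ext d'; simp [hedge]
    simp only [boundary₂, LinearMap.coe_mk, AddHom.coe_mk]
    rw [← Finset.sum_pair (f := fun d => c (S.face d)) (S.flip_ne d).symm, ← this]
  funext v
  have h1 : S.boundary₁ (S.boundary₂ c) v =
      ∑ d with S.vertex d = v, (c (S.face d) + c (S.face (S.flip d))) := by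
    simp only [← h2]
    rfl
  rw [h1, Finset.sum_add_distrib]
  have h3 : ∑ d with S.vertex d = v, c (S.face (S.flip d)) =
      ∑ d with S.vertex d = v, c (S.face d) := by
    symm
    refine Finset.sum_equiv S.rot (fun d => ?_) (fun d _ => by rw [hflip])
    have : S.vertex (S.rot d) = S.vertex d :=
      Quotient.sound (s := Equiv.Perm.SameCycle.setoid S.rot)
        (show S.rot.SameCycle _ _ from ⟨-1, by simp⟩)
    simp [this]
  rw [h3]
  exact CharTwo.add_self_eq_zero _

end CellSurface

/-- The projection of a link diagram on `S`: a union of edges (given by the set of their darts)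
such that every vertex has 0, 2 or 4 ends of these edges. At a vertex with 4 ends two strands cross
transversally; at a vertex with 2 ends a single strand passes through. The other edges of `S` only
serve to cut the complement of the link into disks. -/
structure LinkProjection {D : Type*} [Fintype D] (S : CellSurface D) where
  darts : Set D
  flip_mem : ∀ {d}, d ∈ darts → S.flip d ∈ darts
  valency : ∀ v : S.Vertex,
    {d | d ∈ darts ∧ S.vertex d = v}.ncard ∈ ({0, 2, 4} : Set ℕ)

namespace LinkProjection

variable {D : Type*} [Fintype D] {S : CellSurface D} (P : LinkProjection S)

/-- The number of ends of link edges at a vertex. -/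
def degree (v : S.Vertex) : ℕ := {d | d ∈ P.darts ∧ S.vertex d = v}.ncard

theorem exists_return (a : P.darts) : ∃ k : ℕ, (S.rot ^ (k + 1)) a.1 ∈ P.darts :=
  ⟨orderOf S.rot - 1, by
    rw [Nat.sub_add_cancel (orderOf_pos S.rot), pow_orderOf_eq_one]; exact a.2⟩

open Classical in
/-- The next dart of the link counterclockwise around the initial vertex of `a`. -/
def next (a : P.darts) : P.darts :=
  ⟨(S.rot ^ (Nat.find (P.exists_return a) + 1)) a.1, Nat.find_spec (P.exists_return a)⟩

/-- The dart of the link opposite to `a` at its initial vertex, i.e. the continuation of the strand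
that comes in along `a`: the second next dart at a crossing, the next one at a vertex with 2 ends. -/
def opposite (a : P.darts) : P.darts := P.next^[P.degree (S.vertex a.1) / 2] a

/-- The components of the link: the closed curves that are followed along the edges and straight
ahead through each vertex. -/
def Component : Type _ :=
  Quot fun a b : P.darts => b.1 = S.flip a.1 ∨ b = P.opposite a

/-- The component of the link that contains a given link dart. -/
def component (a : P.darts) : P.Component := Quot.mk _ a

/-- The regions: the connected components of the complement of the link. Two faces are in the same
region exactly if one gets from one to the other across edges that are not in the link. -/
def Region : Type _ :=
  Quot fun f f' : S.Face => ∃ d, d ∉ P.darts ∧ S.face d = f ∧ S.face (S.flip d) = f'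

/-- The region that contains a given face. -/
def region (f : S.Face) : P.Region := Quot.mk _ f

/-- The crossing points. -/
def Crossing : Type _ := {v : S.Vertex // P.degree v = 4}

instance : Finite P.Component := inferInstanceAs (Finite (Quot _))

instance : Finite P.Region := inferInstanceAs (Finite (Quot _))

instance : Finite P.Crossing := inferInstanceAs (Finite (Subtype _))

instance : Fintype P.Crossing := Fintype.ofFinite _

/-- How many times (from 0 to 4) a region appears around a crossing. The four sectors at the
crossing are those between a link dart `a` and the next link dart; such a sector contains the corner
between `a` and `S.rot a`, and its faces are separated only by edges outside the link. -/
def touch (R : P.Region) (v : P.Crossing) : ℕ :=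
  {a | a ∈ P.darts ∧ S.vertex a = v.1 ∧ P.region (S.face a) = R}.ncard

/-- The incidence matrix mod 2, for the double counting rule. -/
def incidenceMatrix : Matrix P.Region P.Crossing (ZMod 2) :=
  Matrix.of fun R v => (P.touch R v : ZMod 2)

open Classical in
/-- The cellular 1-chain of a component: the sum of its edges. -/
def chain (K : P.Component) : S.Edge → ZMod 2 :=
  fun e => if ∃ a, P.component a = K ∧ S.edge a.1 = e then 1 else 0

theorem vertex_next (a : P.darts) : S.vertex (P.next a).1 = S.vertex a.1 :=
  S.vertex_rot_pow _ _

theorem next_reaches (a : P.darts) (n : ℕ) (h : (S.rot ^ n) a.1 ∈ P.darts) :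
    ∃ k : ℕ, P.next^[k] a = ⟨(S.rot ^ n) a.1, h⟩ := by
  classical
  induction n using Nat.strong_induction_on generalizing a with
  | _ n ih =>
    rcases Nat.eq_zero_or_pos n with rfl | hn
    · exact ⟨0, by simp⟩
    · obtain ⟨m, rfl⟩ : ∃ m, n = m + 1 := ⟨n - 1, by omega⟩
      have hle : Nat.find (P.exists_return a) ≤ m := Nat.find_min' _ h
      obtain ⟨t, ht⟩ := Nat.exists_eq_add_of_le hle
      have e : (S.rot ^ t) (P.next a).1 = (S.rot ^ (m + 1)) a.1 := by
        simp only [next]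
        rw [← Equiv.Perm.mul_apply, ← pow_add]
        congr 2
        omega
      obtain ⟨k, hk⟩ := ih t (by omega) (P.next a) (by rw [e]; exact h)
      refine ⟨k + 1, ?_⟩
      rw [Function.iterate_succ_apply, hk]
      exact Subtype.ext e

theorem next_surjective : Function.Surjective P.next := by
  intro b
  obtain ⟨n, hn⟩ := S.exists_rot_pow_of_vertex_eq (P.vertex_next b)
  obtain ⟨k, hk⟩ := P.next_reaches (P.next b) n (by rw [hn]; exact b.2)
  refine ⟨P.next^[k] b, ?_⟩
  rw [← Function.iterate_succ_apply' P.next, Function.iterate_succ_apply, hk]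
  exact Subtype.ext hn

/-- `next` as a permutation of the link darts. -/
def nextPerm : Equiv.Perm P.darts :=
  Equiv.ofBijective P.next (Finite.injective_iff_bijective.1
    (Finite.injective_iff_surjective.2 P.next_surjective))

theorem isCycleOn_nextPerm (v : S.Vertex) :
    P.nextPerm.IsCycleOn {b : P.darts | S.vertex b.1 = v} := by
  refine ⟨?_, ?_⟩
  · have hm : ∀ b : P.darts, S.vertex (P.nextPerm b).1 = S.vertex b.1 := P.vertex_next
    refine ⟨fun b hb => (hm b).trans hb, P.nextPerm.injective.injOn, fun b hb => ?_⟩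
    refine ⟨P.nextPerm.symm b, ?_, by simp⟩
    have := hm (P.nextPerm.symm b)
    rw [Equiv.apply_symm_apply] at this
    exact this.symm.trans hb
  · intro a ha b hb
    obtain ⟨n, hn⟩ := S.exists_rot_pow_of_vertex_eq (Eq.trans ha (Eq.symm hb))
    obtain ⟨k, hk⟩ := P.next_reaches a n (by rw [hn]; exact b.2)
    refine ⟨k, ?_⟩
    rw [zpow_natCast, ← Equiv.Perm.iterate_eq_pow]
    exact hk.trans (Subtype.ext hn)

theorem vertex_next_iterate (a : P.darts) (k : ℕ) :
    S.vertex (P.next^[k] a).1 = S.vertex a.1 := by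
  induction k with
  | zero => rfl
  | succ k ih => rw [Function.iterate_succ_apply', P.vertex_next, ih]

theorem vertex_opposite (a : P.darts) : S.vertex (P.opposite a).1 = S.vertex a.1 :=
  P.vertex_next_iterate _ _

theorem next_iterate_eq_self (a : P.darts) (k : ℕ) :
    P.next^[k] a = a ↔ P.degree (S.vertex a.1) ∣ k := by
  classical
  have h := P.isCycleOn_nextPerm (S.vertex a.1)
  have hc : P.degree (S.vertex a.1) =
      (Finset.univ.filter fun b : P.darts => S.vertex b.1 = S.vertex a.1).card := by
    rw [degree, ← Set.ncard_coe_finset, ← Set.ncard_image_of_injective _ Subtype.val_injective]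
    congr 1
    ext d
    simp [and_comm]
  have h' : P.nextPerm.IsCycleOn
      (Finset.univ.filter fun b : P.darts => S.vertex b.1 = S.vertex a.1 : Finset P.darts) := by
    simpa using h
  rw [hc, ← h'.pow_apply_eq (a := a) (by simp), ← Equiv.Perm.iterate_eq_pow]
  rfl

theorem degree_eq (a : P.darts) :
    P.degree (S.vertex a.1) = 2 ∨ P.degree (S.vertex a.1) = 4 := by
  have h := P.valency (S.vertex a.1)
  have h0 : P.degree (S.vertex a.1) ≠ 0 :=
    Set.ncard_ne_zero_of_mem (a := a.1) ⟨a.2, rfl⟩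
  simp only [Set.mem_insert_iff, Set.mem_singleton_iff] at h
  simp only [degree] at h0 ⊢
  tauto

theorem opposite_ne (a : P.darts) : P.opposite a ≠ a := by
  rw [opposite, Ne, next_iterate_eq_self]
  rcases P.degree_eq a with h | h <;> rw [h] <;> decide

theorem opposite_opposite (a : P.darts) : P.opposite (P.opposite a) = a := by
  conv_lhs => rw [opposite, vertex_opposite, opposite, ← Function.iterate_add_apply]
  rw [next_iterate_eq_self]
  rcases P.degree_eq a with h | h <;> rw [h]

theorem component_opposite (a : P.darts) : P.component (P.opposite a) = P.component a := by
  symm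
  apply Quot.sound
  exact Or.inr rfl

theorem chain_edge (K : P.Component) (d : D) [Decidable (∃ h : d ∈ P.darts, P.component ⟨d, h⟩ = K)] :
    P.chain K (S.edge d) = if ∃ h : d ∈ P.darts, P.component ⟨d, h⟩ = K then 1 else 0 := by
  classical
  simp only [chain]
  congr 1
  refine propext ⟨?_, fun ⟨h, hK⟩ => ⟨⟨d, h⟩, hK, rfl⟩⟩
  rintro ⟨a, rfl, he⟩
  rcases S.eq_or_eq_flip_of_edge_eq he with rfl | rfl
  · exact ⟨a.2, rfl⟩
  · refine ⟨P.flip_mem a.2, ?_⟩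
    symm
    apply Quot.sound
    exact Or.inl rfl

/-- The chain of a component is a cycle. -/
theorem chain_mem_ker (K : P.Component) : P.chain K ∈ LinearMap.ker S.boundary₁ := by
  classical
  rw [LinearMap.mem_ker]
  funext v
  have key : ∑ a ∈ Finset.univ.filter
      (fun a : P.darts => S.vertex a.1 = v ∧ P.component a = K), (1 : ZMod 2) = 0 := by
    refine Finset.sum_involution (fun a _ => P.opposite a) (fun _ _ => by decide)
      (fun a _ _ => P.opposite_ne a) (fun a ha => ?_) (fun a _ => P.opposite_opposite a)
    simpa [P.vertex_opposite, P.component_opposite] using ha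
  rw [Pi.zero_apply, ← key]
  simp only [CellSurface.boundary₁, LinearMap.coe_mk, AddHom.coe_mk, chain_edge]
  rw [← Finset.sum_filter, Finset.filter_filter]
  symm
  refine Finset.sum_bij (fun a _ => a.1) ?_ (fun a _ b _ h => Subtype.ext h) ?_ (fun _ _ => rfl)
  · intro a ha
    simpa using ha
  · intro d hd
    simp only [Finset.mem_filter, Finset.mem_univ, true_and] at hd
    obtain ⟨hv, h, hK⟩ := hd
    exact ⟨⟨d, h⟩, by simp [hv, hK], rfl⟩

/-- The homology class mod 2 of a component of the link. -/
def homologyClass (K : P.Component) : S.H1 :=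
  Submodule.Quotient.mk ⟨P.chain K, P.chain_mem_ker K⟩

/-- The coordinates of the classes of the components `K i` in a basis of the first homology. -/
def homologyMatrix {n m : ℕ} (K : Fin n → P.Component)
    (α : Module.Basis (Fin m) (ZMod 2) S.H1) : Matrix (Fin n) (Fin m) (ZMod 2) :=
  Matrix.of fun i j => α.repr (P.homologyClass (K i)) j

/-- A link diagram with projection `P`: at each crossing, `isUpper` tells which link darts belong to
the upper strand. Going around a crossing one meets the two strands alternately, so `isUpper` is the
same on opposite darts and different on neighbouring ones. -/
@[ext]
structure Diagram where
  isUpper : {a : P.darts // P.degree (S.vertex a.1) = 4} → Bool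
  isUpper_next : ∀ a, isUpper ⟨P.next a.1, by rw [P.vertex_next]; exact a.2⟩ = !isUpper a

variable {P} in
/-- Region crossing change on `R`: each crossing is switched as many times as `R` appears around
it. -/
def Diagram.regionCrossingChange (L : P.Diagram) (R : P.Region) : P.Diagram where
  isUpper a := Bool.not^[P.touch R ⟨S.vertex a.1.1, a.2⟩] (L.isUpper a)
  isUpper_next a := by
    have h : (⟨S.vertex (P.next a.1).1, by rw [P.vertex_next]; exact a.2⟩ : P.Crossing) =
        ⟨S.vertex a.1.1, a.2⟩ := Subtype.ext (P.vertex_next a.1)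
    simp only [h, L.isUpper_next]
    rw [← Function.iterate_succ_apply, Function.iterate_succ_apply']

/-- The classes of the diagrams with projection `P` under the equivalence relation generated by
region crossing changes. -/
def DiagramClass : Type _ :=
  Quot fun L L' : P.Diagram => ∃ R, L' = L.regionCrossingChange R

end LinkProjection

end

/-! Colour the regions by `ZMod 2`. The boundary of a colouring is a 1-chain supported on the link,
and at a crossing its values on two opposite edges differ by the total colour of the four sectors,
which is the change of that crossing. So a colouring changes no crossing iff its boundary is
constant along every component (`ker_crossingMap`). Dually, a sum of components is null-homologous
iff it bounds a colouring (`ker_homologyMap`).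

Let `I` be the space of 1-chains that are both boundaries of colourings and sums of components. Only
constant colourings have zero boundary, and the chains of the components are independent. Hence the
colourings without effect have dimension 1 + dim `I`, while n − rank N = dim `I`. Eliminating dim
`I` and applying rank–nullity gives the rank formula.

For the count, a diagram is a vector in `P.Crossing → ZMod 2` (`code`), and a region crossing change
adds a row of the incidence matrix. Classes are therefore cosets of the row space. -/

theorem LinearMap.finrank_comap_eq {F V W : Type*} [Field F] [AddCommGroup V] [Module F V]
    [FiniteDimensional F V] [AddCommGroup W] [Module F W] (f : V →ₗ[F] W) (U : Submodule F W) :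
    Module.finrank F (U.comap f) =
      Module.finrank F (LinearMap.ker f) + Module.finrank F ↥(LinearMap.range f ⊓ U) := by
  have h := (f.domRestrict (U.comap f)).finrank_range_add_finrank_ker
  have hle : LinearMap.ker f ≤ U.comap f := fun x hx => by
    rw [LinearMap.mem_ker] at hx
    simp [hx]
  have hk : LinearMap.ker (f.domRestrict (U.comap f)) =
      (LinearMap.ker f).comap (U.comap f).subtype := rfl
  rw [hk, (Submodule.comapSubtypeEquivOfLe hle).finrank_eq, LinearMap.range_domRestrict,
    Submodule.map_comap_eq] at h
  omega

theorem ZMod.two_eq_of_add_eq_zero {a b : ZMod 2} (h : a + b = 0) : a = b :=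
  CharTwo.add_eq_zero.1 h

/-! ### Face colourings of the cell complex -/

namespace CellSurface

variable {D : Type*} [Fintype D] (S : CellSurface D)

/-- Both faces occupy the corner between `d` and `S.rot d`. -/
theorem face_flip_rot (d : D) : S.face (S.flip (S.rot d)) = S.face d :=
  Quotient.sound (s := Equiv.Perm.SameCycle.setoid S.facePerm)
    (show S.facePerm.SameCycle _ _ from ⟨1, by simp [facePerm, S.flip_flip]⟩)

theorem edge_flip (d : D) : S.edge (S.flip d) = S.edge d :=
  Quotient.sound (s := Equiv.Perm.SameCycle.setoid S.flip)
    (show S.flip.SameCycle _ _ from ⟨1, by simp [S.flip_flip]⟩)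

theorem boundary₂_edge (c : S.Face → ZMod 2) (d : D) :
    S.boundary₂ c (S.edge d) = c (S.face d) + c (S.face (S.flip d)) := by
  classical
  have : Finset.univ.filter (fun d' => S.edge d' = S.edge d) = {d, S.flip d} := by
    ext d'
    simp only [Finset.mem_filter, Finset.mem_univ, true_and, Finset.mem_insert,
      Finset.mem_singleton]
    refine ⟨fun h => ?_, ?_⟩
    · rcases S.eq_or_eq_flip_of_edge_eq h with h' | h'
      · exact Or.inl h'
      · exact Or.inr (by rw [← h', S.flip_flip])
    · rintro (rfl | rfl)
      · rfl
      · exact S.edge_flip d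
  simp only [boundary₂, LinearMap.coe_mk, AddHom.coe_mk]
  rw [← Finset.sum_pair (f := fun d => c (S.face d)) (S.flip_ne d).symm, ← this]

/-- A function on the darts that is invariant under `rot` and `flip` is constant. -/
theorem eq_of_invariant {X : Type*} {s : D → X} (hrot : ∀ d, s (S.rot d) = s d)
    (hflip : ∀ d, s (S.flip d) = s d) (d d' : D) : s d = s d' := by
  obtain ⟨p, hp, rfl⟩ := S.connected d d'
  have key : ∀ d, s (p d) = s d := by
    induction hp using Subgroup.closure_induction with
    | mem p hp =>
      rcases hp with rfl | rfl
      exacts [hrot, hflip]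
    | one => exact fun _ => rfl
    | mul p q _ _ hp hq => exact fun d => (hp _).trans (hq d)
    | inv p _ hp => exact fun d => by simpa using (hp (p⁻¹ d)).symm
  exact (key d).symm

/-- A face colouring without boundary is constant. -/
theorem eq_of_boundary₂_eq_zero {c : S.Face → ZMod 2} (hc : S.boundary₂ c = 0) (f f' : S.Face) :
    c f = c f' := by
  have hflip : ∀ d, c (S.face (S.flip d)) = c (S.face d) := fun d =>
    (ZMod.two_eq_of_add_eq_zero ((S.boundary₂_edge c d).symm.trans (congrFun hc _))).symm
  induction f using Quotient.inductionOn with | _ d =>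
  induction f' using Quotient.inductionOn with | _ d' =>
  -- Invariance under `rot` follows from invariance under `flip`, since turning past `S.rot d` is
  -- crossing its edge.
  exact S.eq_of_invariant (s := fun d => c (S.face d))
    (fun d => by rw [← hflip, S.face_flip_rot]) hflip d d'

end CellSurface

/-! ### Sectors around a vertex of the link -/

namespace LinkProjection

variable {D : Type*} [Fintype D] {S : CellSurface D} (P : LinkProjection S)

noncomputable instance : Fintype P.Region := Fintype.ofFinite _

noncomputable instance : Fintype P.Component := Fintype.ofFinite _

theorem region_face_flip {d : D} (hd : d ∉ P.darts) :
    P.region (S.face (S.flip d)) = P.region (S.face d) :=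
  (Quot.sound ⟨d, hd, rfl, rfl⟩).symm

/-- The sector after a link dart ends at the next link dart. -/
theorem region_face_flip_next (a : P.darts) :
    P.region (S.face (S.flip (P.next a).1)) = P.region (S.face a.1) := by
  classical
  -- Sweep the corners counterclockwise from `a`: until the next link dart, every edge crossed lies
  -- outside the link.
  have key : ∀ j ≤ Nat.find (P.exists_return a),
      P.region (S.face ((S.rot ^ j) a.1)) = P.region (S.face a.1) := by
    intro j
    induction j with
    | zero => intro _; rfl
    | succ j ih =>
      intro hj
      have hn : (S.rot ^ (j + 1)) a.1 ∉ P.darts := Nat.find_min (P.exists_return a) hj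
      rw [← P.region_face_flip hn, pow_succ', Equiv.Perm.mul_apply, S.face_flip_rot,
        ih (by omega)]
  rw [← key _ le_rfl]
  simp only [next]
  rw [pow_succ', Equiv.Perm.mul_apply, S.face_flip_rot]

/-- The link darts at a vertex, in cyclic order. -/
theorem sum_darts_at [DecidableEq S.Vertex] {M : Type*} [AddCommMonoid M] (f : P.darts → M)
    (a : P.darts) [Fintype P.darts] :
    ∑ b : P.darts with S.vertex b.1 = S.vertex a.1, f b =
      ∑ k ∈ Finset.range (P.degree (S.vertex a.1)), f (P.next^[k] a) := by
  classical
  have hc : P.degree (S.vertex a.1) =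
      (Finset.univ.filter fun b : P.darts => S.vertex b.1 = S.vertex a.1).card := by
    rw [degree, ← Set.ncard_coe_finset, ← Set.ncard_image_of_injective _ Subtype.val_injective]
    congr 1
    ext d
    simp [and_comm]
  have h' : P.nextPerm.IsCycleOn
      (Finset.univ.filter fun b : P.darts => S.vertex b.1 = S.vertex a.1 : Finset P.darts) := by
    simpa using P.isCycleOn_nextPerm (S.vertex a.1)
  have hit : ∀ k, (P.nextPerm ^ k) a = P.next^[k] a := fun k => by
    rw [← Equiv.Perm.iterate_eq_pow]; rfl
  symm
  refine Finset.sum_bij (fun k _ => P.next^[k] a) ?_ ?_ ?_ (fun _ _ => rfl)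
  · intro k _
    simpa using P.vertex_next_iterate a k
  · intro k hk l hl hkl
    rw [← hit, ← hit, h'.pow_apply_eq_pow_apply (by simp), ← hc] at hkl
    exact hkl.eq_of_lt_of_lt (Finset.mem_range.1 hk) (Finset.mem_range.1 hl)
  · intro b hb
    obtain ⟨k, hk, rfl⟩ := h'.exists_pow_eq (a := a) (by simp) hb
    exact ⟨k, by rw [hc]; exact Finset.mem_range.2 hk, (hit k).symm⟩

/-! ### Region colourings: crossing changes and boundaries -/

/-- The total change of each crossing when the regions are changed according to `x`. -/
noncomputable def crossingMap : (P.Region → ZMod 2) →ₗ[ZMod 2] (P.Crossing → ZMod 2) :=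
  Fintype.linearCombination (ZMod 2) P.incidenceMatrix.row

theorem range_crossingMap : LinearMap.range P.crossingMap =
    Submodule.span (ZMod 2) (Set.range P.incidenceMatrix.row) :=
  Fintype.range_linearCombination _ _

theorem finrank_range_crossingMap :
    Module.finrank (ZMod 2) (LinearMap.range P.crossingMap) = P.incidenceMatrix.rank := by
  rw [range_crossingMap, Matrix.rank_eq_finrank_span_row]

/-- Counting by sectors instead of by regions makes the change computable locally at the crossing.
-/
theorem crossingMap_apply [DecidableEq S.Vertex] [Fintype P.darts] (x : P.Region → ZMod 2)
    (v : P.Crossing) :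
    P.crossingMap x v = ∑ a : P.darts with S.vertex a.1 = v.1, x (P.region (S.face a.1)) := by
  classical
  have ht : ∀ R, (P.touch R v : ZMod 2) =
      ∑ a : P.darts with S.vertex a.1 = v.1, if P.region (S.face a.1) = R then 1 else 0 := by
    intro R
    rw [Finset.sum_boole, Finset.filter_filter, touch, ← Set.ncard_coe_finset,
      ← Set.ncard_image_of_injective _ Subtype.val_injective]
    congr 2
    ext d
    simp only [Set.mem_ofPred_eq, Finset.coe_filter, Finset.mem_univ, true_and, Set.mem_image,
      Subtype.exists, exists_and_right, exists_eq_right]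
    tauto
  have h : P.crossingMap x v = ∑ R, x R * (P.touch R v : ZMod 2) := by
    rw [crossingMap, Fintype.linearCombination_apply, Finset.sum_apply]
    rfl
  simp only [h, ht, Finset.mul_sum]
  rw [Finset.sum_comm]
  simp

/-- The boundary of a region colouring. -/
noncomputable def regionBoundary : (P.Region → ZMod 2) →ₗ[ZMod 2] (S.Edge → ZMod 2) :=
  S.boundary₂ ∘ₗ LinearMap.funLeft (ZMod 2) (ZMod 2) P.region

theorem regionBoundary_edge (x : P.Region → ZMod 2) (d : D) :
    P.regionBoundary x (S.edge d) =
      x (P.region (S.face d)) + x (P.region (S.face (S.flip d))) :=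
  S.boundary₂_edge _ d

theorem regionBoundary_edge_next (x : P.Region → ZMod 2) (a : P.darts) :
    P.regionBoundary x (S.edge (P.next a).1) =
      x (P.region (S.face (P.next a).1)) + x (P.region (S.face a.1)) := by
  rw [regionBoundary_edge, region_face_flip_next]

theorem regionBoundary_edge_of_notMem (x : P.Region → ZMod 2) {d : D} (hd : d ∉ P.darts) :
    P.regionBoundary x (S.edge d) = 0 := by
  rw [regionBoundary_edge, P.region_face_flip hd]
  exact CharTwo.add_self_eq_zero _

theorem next_iterate_degree (a : P.darts) : P.next^[P.degree (S.vertex a.1)] a = a :=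
  (P.next_iterate_eq_self a _).2 dvd_rfl

/-- Only two sectors meet here, and both edges separate them. -/
theorem regionBoundary_opposite_of_degree_two (x : P.Region → ZMod 2) (a : P.darts)
    (ha : P.degree (S.vertex a.1) = 2) :
    P.regionBoundary x (S.edge (P.opposite a).1) = P.regionBoundary x (S.edge a.1) := by
  have h := P.next_iterate_degree a
  have ho : P.opposite a = P.next a := by rw [opposite, ha]; rfl
  rw [ha] at h
  change P.next (P.next a) = a at h
  rw [ho]
  conv_rhs => rw [← h]
  rw [regionBoundary_edge_next, regionBoundary_edge_next, h, add_comm]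

/-- At a crossing, the change of the boundary along a strand is the total colour of the sectors. -/
theorem regionBoundary_opposite_add (x : P.Region → ZMod 2) (a : P.darts)
    (ha : P.degree (S.vertex a.1) = 4) :
    P.regionBoundary x (S.edge (P.opposite a).1) + P.regionBoundary x (S.edge a.1) =
      P.crossingMap x ⟨S.vertex a.1, ha⟩ := by
  classical
  have h := P.next_iterate_degree a
  have ho : P.opposite a = P.next (P.next a) := by rw [opposite, ha]; rfl
  -- The fourth step returns to `a`, so the edge of `a` separates sectors 3 and 0, while the
  -- opposite edge separates sectors 1 and 2.
  have e := P.regionBoundary_edge_next x (P.next (P.next (P.next a)))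
  refine Eq.trans ?_ ((P.crossingMap_apply x ⟨S.vertex a.1, ha⟩).trans
    (P.sum_darts_at (fun b => x (P.region (S.face b.1))) a)).symm
  rw [ho, ha, regionBoundary_edge_next]
  rw [ha] at h
  change P.next (P.next (P.next (P.next a))) = a at h
  rw [h] at e
  rw [e]
  simp only [Finset.sum_range_succ, Finset.sum_range_zero, Function.iterate_succ_apply,
    Function.iterate_zero_apply]
  ring

/-! ### Sums of components and the two kernels -/

/-- The 1-chain of a linear combination of components. -/
noncomputable def componentChain : (P.Component → ZMod 2) →ₗ[ZMod 2] (S.Edge → ZMod 2) :=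
  Fintype.linearCombination (ZMod 2) P.chain

theorem componentChain_edge (y : P.Component → ZMod 2) (a : P.darts) :
    P.componentChain y (S.edge a.1) = y (P.component a) := by
  classical
  simp only [componentChain, Fintype.linearCombination_apply, Finset.sum_apply, Pi.smul_apply,
    smul_eq_mul, chain_edge, a.2, exists_true_left]
  simp

theorem componentChain_edge_of_notMem (y : P.Component → ZMod 2) {d : D} (hd : d ∉ P.darts) :
    P.componentChain y (S.edge d) = 0 := by
  classical
  simp [componentChain, Fintype.linearCombination_apply, chain_edge, hd]

/-- Distinct components share no edge, so each coefficient can be read off at any dart of its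
component. -/
theorem ker_componentChain : LinearMap.ker P.componentChain = ⊥ := by
  rw [LinearMap.ker_eq_bot']
  intro y hy
  funext K
  induction K using Quot.inductionOn with | _ a =>
  exact (P.componentChain_edge y a).symm.trans (congrFun hy _)

/-- A region colouring changes no crossing exactly if its boundary is a union of components. -/
theorem ker_crossingMap :
    LinearMap.ker P.crossingMap = (LinearMap.range P.componentChain).comap P.regionBoundary := by
  ext x
  rw [LinearMap.mem_ker, Submodule.mem_comap, LinearMap.mem_range]
  constructor
  · intro hx
    have hopp : ∀ a : P.darts,
        P.regionBoundary x (S.edge (P.opposite a).1) = P.regionBoundary x (S.edge a.1) := by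
      intro a
      rcases P.degree_eq a with h | h
      · exact P.regionBoundary_opposite_of_degree_two x a h
      · apply ZMod.two_eq_of_add_eq_zero
        rw [P.regionBoundary_opposite_add x a h, hx]
        rfl
    -- The boundary is constant along strands, so it descends to a coefficient for each component.
    refine ⟨Quot.lift (fun a : P.darts => P.regionBoundary x (S.edge a.1)) ?_, ?_⟩
    · rintro a b (h | h)
      · simp only [h, S.edge_flip]
      · simp only [h, hopp]
    · funext e
      induction e using Quotient.inductionOn with | _ d =>
      by_cases hd : d ∈ P.darts
      · exact P.componentChain_edge _ ⟨d, hd⟩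
      · exact (P.componentChain_edge_of_notMem _ hd).trans
          (P.regionBoundary_edge_of_notMem x hd).symm
  · rintro ⟨y, hy⟩
    funext ⟨v, hv⟩
    obtain ⟨d, hd, rfl⟩ := Set.nonempty_of_ncard_ne_zero (hv.trans_ne four_ne_zero)
    rw [← P.regionBoundary_opposite_add x ⟨d, hd⟩ hv, ← hy, componentChain_edge,
      componentChain_edge, component_opposite]
    exact CharTwo.add_self_eq_zero _

/-- The kernel consists of the constant colourings, because the surface is connected; this is the −1
in the rank formula. -/
theorem finrank_ker_regionBoundary :
    Module.finrank (ZMod 2) (LinearMap.ker P.regionBoundary) = 1 := by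
  have h : LinearMap.ker P.regionBoundary = Submodule.span (ZMod 2) {fun _ => 1} := by
    ext x
    rw [LinearMap.mem_ker, Submodule.mem_span_singleton]
    obtain ⟨d₀⟩ := S.nonempty
    constructor
    · intro hx
      refine ⟨x (P.region (S.face d₀)), funext fun R => ?_⟩
      induction R using Quot.inductionOn with | _ f =>
      exact (mul_one _).trans (S.eq_of_boundary₂_eq_zero hx (S.face d₀) f)
    · rintro ⟨t, rfl⟩
      funext e
      induction e using Quotient.inductionOn with | _ d =>
      exact (P.regionBoundary_edge _ d).trans (CharTwo.add_self_eq_zero _)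
  rw [h, finrank_span_singleton]
  obtain ⟨d₀⟩ := S.nonempty
  exact fun h0 => one_ne_zero (congrFun h0 (P.region (S.face d₀)))

/-- The homology class of a linear combination of components. -/
noncomputable def homologyMap : (P.Component → ZMod 2) →ₗ[ZMod 2] S.H1 :=
  Fintype.linearCombination (ZMod 2) P.homologyClass

theorem homologyMap_eq_zero_iff (y : P.Component → ZMod 2) :
    P.homologyMap y = 0 ↔ P.componentChain y ∈ LinearMap.range S.boundary₂ := by
  have h : P.homologyMap y = Submodule.Quotient.mk
      (∑ K, y K • (⟨P.chain K, P.chain_mem_ker K⟩ : LinearMap.ker S.boundary₁)) := by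
    rw [← Submodule.mkQ_apply, map_sum]
    rfl
  rw [h, Submodule.Quotient.mk_eq_zero, Submodule.submoduleOf, Submodule.mem_comap, map_sum]
  rfl

/-- A union of components is null-homologous exactly if it bounds a union of regions. -/
theorem ker_homologyMap :
    LinearMap.ker P.homologyMap = (LinearMap.range P.regionBoundary).comap P.componentChain := by
  ext y
  rw [LinearMap.mem_ker, homologyMap_eq_zero_iff, Submodule.mem_comap, LinearMap.mem_range,
    LinearMap.mem_range]
  constructor
  · rintro ⟨c, hc⟩
    -- The chain vanishes off the link, so a face colouring that it bounds agrees across every edge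
    -- outside the link and descends to regions.
    refine ⟨Quot.lift c ?_, hc⟩
    rintro f f' ⟨d, hd, rfl, rfl⟩
    apply ZMod.two_eq_of_add_eq_zero
    rw [← S.boundary₂_edge, hc, P.componentChain_edge_of_notMem y hd]
  · rintro ⟨x, hx⟩
    exact ⟨_, hx⟩

theorem finrank_range_homologyMap {n m : ℕ} (K : Fin n ≃ P.Component)
    (α : Module.Basis (Fin m) (ZMod 2) S.H1) :
    Module.finrank (ZMod 2) (LinearMap.range P.homologyMap) = (P.homologyMatrix K α).rank := by
  have h : Set.range (P.homologyMatrix K α).row = α.equivFun '' Set.range P.homologyClass := by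
    rw [← K.surjective.range_comp, ← Set.range_comp]
    rfl
  rw [Matrix.rank_eq_finrank_span_row, h, Submodule.span_image_linearEquiv, homologyMap,
    Fintype.range_linearCombination]
  exact (α.equivFun.submoduleMap _).finrank_eq

/-- Both kernels are preimages, and `LinearMap.finrank_comap_eq` expresses their dimensions by the
same intersection of ranges, which then cancels. -/
theorem finrank_ker_crossingMap_add {n m : ℕ} (K : Fin n ≃ P.Component)
    (α : Module.Basis (Fin m) (ZMod 2) S.H1) :
    Module.finrank (ZMod 2) (LinearMap.ker P.crossingMap) + (P.homologyMatrix K α).rank =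
      n + 1 := by
  have h := P.homologyMap.finrank_range_add_finrank_ker
  have hn : Fintype.card P.Component = n := by simpa using (Fintype.card_congr K).symm
  rw [Module.finrank_pi, hn, finrank_range_homologyMap P K α, ker_homologyMap,
    LinearMap.finrank_comap_eq, ker_componentChain, finrank_bot] at h
  rw [ker_crossingMap, LinearMap.finrank_comap_eq, finrank_ker_regionBoundary, inf_comm]
  omega

/-- The formula is over ℤ because r − n − 1 can be negative: a meridian and a longitude of a torus
have r = 1 and n = 2. -/
theorem rank_incidenceMatrix {n m : ℕ} (K : Fin n ≃ P.Component)
    (α : Module.Basis (Fin m) (ZMod 2) S.H1) :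
    (P.incidenceMatrix.rank : ℤ) =
      (Nat.card P.Region : ℤ) - n - 1 + (P.homologyMatrix K α).rank := by
  have h := P.crossingMap.finrank_range_add_finrank_ker
  have h' := P.finrank_ker_crossingMap_add K α
  rw [Module.finrank_pi, finrank_range_crossingMap, ← Nat.card_eq_fintype_card] at h
  omega

/-! ### Diagrams as vectors over `ZMod 2`, and their classes -/

theorem exists_dart_at (v : P.Crossing) : ∃ a : P.darts, S.vertex a.1 = v.1 := by
  obtain ⟨d, hd, hv⟩ := Set.nonempty_of_ncard_ne_zero (v.2.trans_ne four_ne_zero)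
  exact ⟨⟨d, hd⟩, hv⟩

/-- A reference dart at each crossing. -/
noncomputable def baseDart (v : P.Crossing) : P.darts := (P.exists_dart_at v).choose

theorem vertex_baseDart (v : P.Crossing) : S.vertex (P.baseDart v).1 = v.1 :=
  (P.exists_dart_at v).choose_spec

theorem degree_baseDart (v : P.Crossing) : P.degree (S.vertex (P.baseDart v).1) = 4 := by
  rw [vertex_baseDart, v.2]

theorem exists_next_iterate_eq {a b : P.darts} (h : S.vertex a.1 = S.vertex b.1) :
    ∃ k : ℕ, P.next^[k] a = b := by
  obtain ⟨m, hm⟩ := S.exists_rot_pow_of_vertex_eq h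
  obtain ⟨k, hk⟩ := P.next_reaches a m (by rw [hm]; exact b.2)
  exact ⟨k, hk.trans (Subtype.ext hm)⟩

/-- At a crossing, the parity of the number of steps between two darts is well defined. -/
theorem not_iterate_eq_of_next_iterate_eq {a : P.darts} (ha : P.degree (S.vertex a.1) = 4)
    {k l : ℕ} (h : P.next^[k] a = P.next^[l] a) (t : Bool) :
    Bool.not^[k] t = Bool.not^[l] t := by
  wlog hkl : k ≤ l generalizing k l
  · exact (this h.symm (le_of_not_ge hkl)).symm
  obtain ⟨j, rfl⟩ := Nat.exists_eq_add_of_le hkl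
  have hj : P.next^[j] a = a := by
    rw [Function.iterate_add_apply] at h
    exact ((P.nextPerm.injective.iterate k) h).symm
  -- The step counts differ by a multiple of 4, and four negations cancel.
  rw [next_iterate_eq_self, ha] at hj
  obtain ⟨i, rfl⟩ := hj
  have hinv : Bool.not^[4] = id := by funext b; cases b <;> rfl
  rw [Function.iterate_add_apply, Function.iterate_mul, hinv, Function.iterate_id, id]

namespace Diagram

variable {P}

theorem isUpper_next_iterate (L : P.Diagram) (a : {a : P.darts // P.degree (S.vertex a.1) = 4})
    (k : ℕ) : L.isUpper ⟨P.next^[k] a.1, by rw [P.vertex_next_iterate]; exact a.2⟩ =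
      Bool.not^[k] (L.isUpper a) := by
  induction k with
  | zero => rfl
  | succ k ih =>
    rw [Function.iterate_succ_apply' Bool.not, ← ih, ← L.isUpper_next]
    congr 2
    exact Function.iterate_succ_apply' _ _ _

/-- The diagram as a function on the crossings: is the reference dart on the upper strand? -/
noncomputable def code (L : P.Diagram) (v : P.Crossing) : ZMod 2 :=
  if L.isUpper ⟨P.baseDart v, P.degree_baseDart v⟩ then 1 else 0

/-- Upper and lower alternate around a crossing, so the value at the reference dart determines the
other three. -/
theorem code_injective : Function.Injective (code (P := P)) := by
  intro L L' h
  ext a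
  have hv := congrFun h ⟨S.vertex a.1.1, a.2⟩
  have hb : L.isUpper ⟨_, P.degree_baseDart ⟨S.vertex a.1.1, a.2⟩⟩ =
      L'.isUpper ⟨_, P.degree_baseDart ⟨S.vertex a.1.1, a.2⟩⟩ := by
    simp only [code] at hv
    split_ifs at hv <;> simp_all
  obtain ⟨k, hk⟩ := P.exists_next_iterate_eq (P.vertex_baseDart ⟨S.vertex a.1.1, a.2⟩)
  have hL := L.isUpper_next_iterate ⟨_, P.degree_baseDart ⟨S.vertex a.1.1, a.2⟩⟩ k
  have hL' := L'.isUpper_next_iterate ⟨_, P.degree_baseDart ⟨S.vertex a.1.1, a.2⟩⟩ k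
  simp only [hk] at hL hL'
  rw [hL, hL', hb]

theorem code_surjective : Function.Surjective (code (P := P)) := by
  intro z
  have hex : ∀ a : {a : P.darts // P.degree (S.vertex a.1) = 4}, ∃ k : ℕ,
      P.next^[k] (P.baseDart ⟨S.vertex a.1.1, a.2⟩) = a.1 := fun a =>
    P.exists_next_iterate_eq (P.vertex_baseDart ⟨S.vertex a.1.1, a.2⟩)
  -- `k a` is an arbitrary number of steps from the reference dart to `a`; only its parity matters,
  -- and that is well defined.
  choose k hk using hex
  let L : P.Diagram :=
    { isUpper := fun a => Bool.not^[k a] (decide (z ⟨S.vertex a.1.1, a.2⟩ = 1))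
      isUpper_next := fun a => by
        have h : (⟨S.vertex (P.next a.1).1, by rw [P.vertex_next]; exact a.2⟩ : P.Crossing) =
            ⟨S.vertex a.1.1, a.2⟩ := Subtype.ext (P.vertex_next a.1)
        have hk' := hk ⟨P.next a.1, by rw [P.vertex_next]; exact a.2⟩
        simp only [h] at hk' ⊢
        rw [← Function.iterate_succ_apply' Bool.not]
        refine P.not_iterate_eq_of_next_iterate_eq
          (P.degree_baseDart ⟨S.vertex a.1.1, a.2⟩) ?_ _
        rw [hk', Function.iterate_succ_apply', hk] }
  refine ⟨L, funext fun v => ?_⟩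
  have h : (⟨S.vertex (P.baseDart v).1, P.degree_baseDart v⟩ : P.Crossing) = v :=
    Subtype.ext (P.vertex_baseDart v)
  have h0 := hk ⟨P.baseDart v, P.degree_baseDart v⟩
  simp only [h] at h0
  -- The number chosen for the reference dart itself need not be 0, but it acts as 0 does.
  have h1 := P.not_iterate_eq_of_next_iterate_eq (l := 0) (P.degree_baseDart v) h0
    (decide (z v = 1))
  simp only [code, L, h, h1, Function.iterate_zero_apply, decide_eq_true_eq]
  generalize z v = t
  revert t
  decide

theorem ite_not_iterate (k : ℕ) (t : Bool) :
    (if Bool.not^[k] t then 1 else 0 : ZMod 2) = (if t then 1 else 0) + (k : ZMod 2) := by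
  induction k generalizing t with
  | zero => rw [Nat.cast_zero, add_zero, Function.iterate_zero_apply]
  | succ k ih =>
    rw [Function.iterate_succ_apply, ih, Nat.cast_succ]
    cases t <;> grind

theorem code_regionCrossingChange (L : P.Diagram) (R : P.Region) :
    (L.regionCrossingChange R).code = L.code + P.incidenceMatrix.row R := by
  funext v
  have h : (⟨S.vertex (P.baseDart v).1, P.degree_baseDart v⟩ : P.Crossing) = v :=
    Subtype.ext (P.vertex_baseDart v)
  simp only [code, regionCrossingChange, h, ite_not_iterate]
  rfl

/-- Each row is realised by one region crossing change. For a sum, surjectivity of `code` supplies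
the intermediate diagram, and the only scalars are 0 and 1. -/
theorem mk_eq_of_code_sub_mem {z : P.Crossing → ZMod 2}
    (hz : z ∈ Submodule.span (ZMod 2) (Set.range P.incidenceMatrix.row)) :
    ∀ L L' : P.Diagram, L'.code = L.code + z → (Quot.mk _ L : P.DiagramClass) = Quot.mk _ L' := by
  induction hz using Submodule.span_induction with
  | mem z hz =>
    obtain ⟨R, rfl⟩ := hz
    intro L L' h
    exact Quot.sound ⟨R, code_injective (h.trans (L.code_regionCrossingChange R).symm)⟩
  | zero =>
    intro L L' h
    rw [add_zero] at h
    rw [code_injective h]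
  | add z w _ _ hz hw =>
    intro L L' h
    obtain ⟨L'', h''⟩ := code_surjective (L.code + z)
    exact (hz L L'' h'').trans (hw L'' L' (by rw [h, h'', add_assoc]))
  | smul t z _ hz =>
    intro L L' h
    obtain rfl | rfl : t = 0 ∨ t = 1 := by clear h; revert t; decide
    · rw [zero_smul, add_zero] at h
      rw [code_injective h]
    · exact hz L L' (by rwa [one_smul] at h)

end Diagram

/-- The classes of diagrams are the cosets of the row space of the incidence matrix. -/
noncomputable def diagramClassEquiv :
    P.DiagramClass ≃ (P.Crossing → ZMod 2) ⧸ LinearMap.range P.crossingMap :=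
  Equiv.ofBijective
    (Quot.lift (fun L : P.Diagram => Submodule.Quotient.mk L.code) (by
      rintro L _ ⟨R, rfl⟩
      rw [Diagram.code_regionCrossingChange, eq_comm, Submodule.Quotient.eq, add_sub_cancel_left,
        range_crossingMap]
      exact Submodule.subset_span ⟨R, rfl⟩)) (by
    constructor
    · intro A B h
      induction A using Quot.inductionOn with | _ L =>
      induction B using Quot.inductionOn with | _ L' =>
      have h' := (Submodule.Quotient.eq _).1 (Eq.symm h)
      rw [range_crossingMap] at h'
      exact Diagram.mk_eq_of_code_sub_mem h' L L' (by abel)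
    · intro z
      obtain ⟨z, rfl⟩ := Submodule.Quotient.mk_surjective _ z
      obtain ⟨L, rfl⟩ := Diagram.code_surjective z
      exact ⟨Quot.mk _ L, rfl⟩)

/-- The subtraction in ℕ does not truncate, since the row space lies in a space of dimension c. -/
theorem card_diagramClass :
    Nat.card P.DiagramClass = 2 ^ (Nat.card P.Crossing - P.incidenceMatrix.rank) := by
  rw [Nat.card_congr P.diagramClassEquiv, Module.natCard_eq_pow_finrank (K := ZMod 2),
    Nat.card_zmod, Submodule.finrank_quotient, finrank_range_crossingMap, Module.finrank_pi,
    Nat.card_eq_fintype_card]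

end LinkProjection

theorem theorem4 {D : Type*} [Fintype D] (S : CellSurface D) (g : ℕ)
    (hg : S.eulerChar = 2 - 2 * (g : ℤ))
    (α : Module.Basis (Fin (2 * g)) (ZMod 2) S.H1)
    (P : LinkProjection S) (n : ℕ) (K : Fin n ≃ P.Component) :
    (P.incidenceMatrix.rank : ℤ) =
        (Nat.card P.Region : ℤ) - n - 1 + (P.homologyMatrix K α).rank ∧
      Nat.card P.DiagramClass = 2 ^ (Nat.card P.Crossing - P.incidenceMatrix.rank) :=
  ⟨P.rank_incidenceMatrix K α, P.card_diagramClass⟩
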